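/- A model of $\mathbb{R}\text{-OVSA}$ is a (possibly trivial) ordered $\mathbb{R}$-vector space $A$, i.e. an $\mathbb{R}$-vector space with a linear order compatible with addition and with multiplication by positive reals, together with an automorphism $\sigma$ of the ordered $\mathbb{R}$-vector space $A$ (in a language containing symbols for $+,0,-,<$, multiplication by each real number, $\sigma$ and $\sigma^{-1}$). An embedding of models is a strictly increasing $\mathbb{R}$-linear map that commutes with $\sigma$; an extension $A\subseteq B$ of models is a model $B$ having $A$ as a substructure (equivalently, up to isomorphism, an embedding of $A$ into $B$). A $\sigma$-polynomial over $A$ is an expression $f(x)+d$ with $f=\sum_{k} r_k\sigma^k$ an element of the polynomial ring $\mathbb{R}[\sigma]$ and $d\in A$; it is nonzero if $f\neq 0$ in $\mathbb{R}[\sigma]$ or $d\ne 0$. An element $b$ of an extension of $A$ is a root of it if $\sum_k r_k\sigma^k(b)+d=0$. **Theorem.** Let $A$, $B$, $C$ be models of $\mathbb{R}\text{-OVSA}$ with $A\subseteq B$ and $A\subseteq C$. Suppose that every element of $B$ is a root of a nonzero $\sigma$-polynomial over $A$. Then $B$ and $C$ amalgamate over $A$ in the class of models of $\mathbb{R}\text{-OVSA}$: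 there are a model $D$ of $\mathbb{R}\text{-OVSA}$ and embeddings $g\colon B\to D$ and $h\colon C\to D$ that agree on $A$. -/

import Mathlib

open Polynomial

universe u v

/-- A model of `R-OVSA`: a (possibly trivial) ordered vector space over the ordered field `R`,
together with an automorphism `σ` of the ordered `R`-vector space
(its inverse `σ⁻¹` is the inverse `σ.symm` of the linear equivalence). -/
structure OVSA (R : Type v) [Field R] [LinearOrder R] [IsStrictOrderedRing R] where
  carrier : Type u
  [addCommGroup : AddCommGroup carrier]
  [linearOrder : LinearOrder carrier]
  [isOrderedAddMonoid : IsOrderedAddMonoid carrier]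
  [module : Module R carrier]
  [isStrictOrderedModule : IsStrictOrderedModule R carrier]
  σ : carrier ≃ₗ[R] carrier
  σ_strictMono : StrictMono σ

namespace OVSA

variable {R : Type v} [Field R] [LinearOrder R] [IsStrictOrderedRing R]

instance : CoeSort (OVSA.{u} R) (Type u) := ⟨OVSA.carrier⟩

attribute [instance] addCommGroup linearOrder isOrderedAddMonoid module isStrictOrderedModule

/-- An embedding of models of `R-OVSA`: an `R`-linear strictly increasing map which commutes with
the automorphisms (hence also with their inverses). Since the orders are linear, such a map is
injective and reflects the order. -/
structure Embedding (A B : OVSA.{u} R) extends A.carrier →ₗ[R] B.carrier where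
  strictMono' : StrictMono toFun
  map_σ' : ∀ a : A, toFun (A.σ a) = B.σ (toFun a)

instance (A B : OVSA.{u} R) : CoeFun (Embedding A B) (fun _ => A → B) :=
  ⟨fun i => i.toLinearMap⟩

/-- A `σ`-polynomial `f(x) + d` over `A`, given by `f ∈ R[σ]` and the constant `d ∈ A`. It is
zero exactly when `f = 0` (as a formal polynomial in `σ`) and `d = 0`. -/
abbrev SigmaPolynomial (A : OVSA.{u} R) : Type (max u v) := R[X] × A.carrier

/-- The value `f(b) + d = ∑ rᵢ σⁱ(b) + d` of the `σ`-polynomial `f(x) + d` over `A` at an element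
`b` of an extension `i : A → B`. -/
noncomputable def SigmaPolynomial.eval {A B : OVSA.{u} R} (i : Embedding A B)
    (p : SigmaPolynomial A) (b : B) : B :=
  (p.1.sum fun n r => r • (B.σ : B → B)^[n] b) + i p.2

/-- `B` and `C`, seen as extensions of `A` by the embeddings `i` and `j`, amalgamate over `A` in the
class of models of `R-OVSA`: both embed into a common model, and the embeddings agree on `A`. -/
def AmalgamateOver {A B C : OVSA.{u} R} (i : Embedding A B) (j : Embedding A C) : Prop :=
  ∃ (D : OVSA.{u} R) (g : Embedding B D) (h : Embedding C D), ∀ a : A, g (i a) = h (j a)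

end OVSA

/-! Give `B × C` the product order and look for a total `σ`-stable cone whose quotient by its
lineality space is the amalgam. The cone must contain every `(i a, -j a)`, so that the two copies of
`A` become equal, and no negative element, so that `B` and `C` stay strictly ordered. The cone
generated by the nonnegative elements and the `(i a, -j a)` qualifies. Zorn's lemma
(`exists_total_submodule`) makes it total: Laurent polynomials in `σ` with nonnegative coefficients
commute, and the nonzero ones are strictly positive. -/

/-- Let the semiring `T` act on an ordered group by strictly positive, pairwise commuting operators.
A `T`-stable cone which contains no negative element extends to a total one. -/
theorem exists_total_submodule {T M : Type*} [Semiring T] [AddCommGroup M] [PartialOrder M]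
    [IsOrderedAddMonoid M] [Module T M] [SMulCommClass T T M]
    (hpos : ∀ t : T, t ≠ 0 → ∀ x : M, 0 < x → 0 < t • x) (P₀ : Submodule T M)
    (hP₀ : ∀ x : M, 0 < x → -x ∉ P₀) :
    ∃ P : Submodule T M, P₀ ≤ P ∧ (∀ x : M, 0 < x → -x ∉ P) ∧ ∀ x, x ∈ P ∨ -x ∈ P := by
  obtain ⟨P, hle, hmax⟩ := zorn_le_nonempty₀ {P : Submodule T M | ∀ x : M, 0 < x → -x ∉ P}
    (fun c hc hchain Q hQ => by
      refine ⟨sSup c, fun x hx hmem => ?_, fun R hR => le_sSup hR⟩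
      obtain ⟨R, hR, hxR⟩ := (Submodule.mem_sSup_of_directed ⟨Q, hQ⟩ hchain.directedOn).1 hmem
      exact hc hR x hx hxR) P₀ hP₀
  refine ⟨P, hle, hmax.prop, fun m => ?_⟩
  have key : ∀ y : M, y ∉ P → ∃ x : M, 0 < x ∧ ∃ t : T, t ≠ 0 ∧ ∃ p ∈ P, p + t • y = -x := by
    intro y hy
    by_contra! h
    -- By maximality, adjoining `y` must produce a negative element.
    refine hy (hmax.le_of_ge (y := P ⊔ Submodule.span T {y}) ?_ le_sup_left
      (le_sup_right (a := P) (Submodule.mem_span_singleton_self y)))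
    intro x hx hmem
    obtain ⟨p, hp, z, hz, hpz⟩ := Submodule.mem_sup.1 hmem
    obtain ⟨t, rfl⟩ := Submodule.mem_span_singleton.1 hz
    rcases eq_or_ne t 0 with rfl | ht
    · rw [zero_smul, add_zero] at hpz
      exact hmax.prop x hx (hpz ▸ hp)
    · exact h x hx t ht p hp hpz
  by_contra! hm
  obtain ⟨x, hx, t, ht, p, hp, hpx⟩ := key m hm.1
  obtain ⟨y, hy, s, hs, q, hq, hqy⟩ := key (-m) hm.2
  -- Eliminate `m` between `p + t • m = -x` and `q - s • m = -y`; commutation of `s` and `t` cancels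
  -- the `m` terms and leaves a negative element of `P`.
  refine hmax.prop (s • x + t • y) (add_pos (hpos s hs x hx) (hpos t ht y hy)) ?_
  have : -(s • x + t • y) = s • p + t • q := by
    have h1 : s • p + s • t • m = -(s • x) := by rw [← smul_add, hpx, smul_neg]
    have h2 : t • q + -(s • t • m) = -(t • y) := by
      rw [smul_comm s t m, ← smul_neg, ← smul_neg, ← smul_add, hqy, smul_neg]
    rw [neg_add, ← h1, ← h2]
    abel
  rw [this]
  exact P.add_mem (P.smul_mem s hp) (P.smul_mem t hq)

section PositiveOperators

variable {R : Type*} [Field R] [LinearOrder R] {M : Type*} [AddCommGroup M] [Module R M]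

/-- The generators of `positiveOperators σ`. -/
def positiveGenerators (σ : M ≃ₗ[R] M) : Set (Module.End R M) :=
  {f | f = σ.toLinearMap ∨ f = σ.symm.toLinearMap ∨ ∃ r : R, 0 ≤ r ∧ f = r • LinearMap.id}

/-- The Laurent polynomials in `σ` with nonnegative coefficients, as operators. -/
def positiveOperators (σ : M ≃ₗ[R] M) : Subsemiring (Module.End R M) :=
  Subsemiring.closure (positiveGenerators σ)

theorem commute_of_mem_positiveOperators {σ : M ≃ₗ[R] M} {f g : Module.End R M}
    (hf : f ∈ positiveOperators σ) (hg : g ∈ positiveOperators σ) : Commute f g := by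
  have hgen : ∀ f ∈ positiveGenerators σ, ∀ g ∈ positiveGenerators σ, Commute f g := by
    rintro f (rfl | rfl | ⟨r, -, rfl⟩) g (rfl | rfl | ⟨s, -, rfl⟩) <;>
      refine LinearMap.ext fun x => ?_ <;> simp [smul_smul, mul_comm]
  have hcomm : ∀ {s : Set (Module.End R M)} {h k : Module.End R M}, (∀ f ∈ s, Commute f h) →
      k ∈ Subsemiring.closure s → Commute k h := by
    intro s h k hs hk
    induction hk using Subsemiring.closure_induction with
    | mem x hx => exact hs x hx
    | zero => exact Commute.zero_left h
    | one => exact Commute.one_left h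
    | add x y _ _ hx hy => exact hx.add_left hy
    | mul x y _ _ hx hy => exact hx.mul_left hy
  exact hcomm (fun k hk => (hcomm (fun l hl => hgen l hl k hk) hg).symm) hf

instance (σ : M ≃ₗ[R] M) : SMulCommClass (positiveOperators σ) (positiveOperators σ) M :=
  ⟨fun f g x => congrArg (fun h : Module.End R M => h x)
    (commute_of_mem_positiveOperators f.2 g.2).eq⟩

/-- Sums and composites of strictly positive operators are strictly positive: nonnegative
coefficients allow no cancellation. -/
theorem eq_zero_or_pos_of_mem_positiveOperators [PartialOrder M] [IsOrderedAddMonoid M]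
    {σ : M ≃ₗ[R] M} (hR : ∀ r : R, 0 < r → ∀ x : M, 0 < x → 0 < r • x) (hσ : ∀ x, 0 < x → 0 < σ x)
    (hσ' : ∀ x, 0 < x → 0 < σ.symm x) {f : Module.End R M} (hf : f ∈ positiveOperators σ) :
    f = 0 ∨ ∀ x, 0 < x → 0 < f x := by
  induction hf using Subsemiring.closure_induction with
  | mem f hf =>
    rcases hf with rfl | rfl | ⟨r, hr, rfl⟩
    · exact Or.inr hσ
    · exact Or.inr hσ'
    · rcases hr.eq_or_lt with rfl | hr
      · exact Or.inl (zero_smul _ _)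
      · exact Or.inr (hR r hr)
  | zero => exact Or.inl rfl
  | one => exact Or.inr fun x hx => hx
  | add f g _ _ hf hg =>
    rcases hf with rfl | hf
    · simpa using hg
    · rcases hg with rfl | hg
      · exact Or.inr (by simpa using hf)
      · exact Or.inr fun x hx => add_pos (hf x hx) (hg x hx)
  | mul f g _ _ hf hg =>
    rcases hf with rfl | hf
    · exact Or.inl (zero_mul g)
    · rcases hg with rfl | hg
      · exact Or.inl (mul_zero f)
      · exact Or.inr fun x hx => hf _ (hg x hx)

/-- An additive submonoid stable under `σ`, `σ⁻¹` and nonnegative scalars, as a submodule over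
`positiveOperators σ`. -/
def submoduleOfStable (σ : M ≃ₗ[R] M) (P : AddSubmonoid M) (h₁ : ∀ x ∈ P, σ x ∈ P)
    (h₂ : ∀ x ∈ P, σ.symm x ∈ P) (h₃ : ∀ r : R, 0 ≤ r → ∀ x ∈ P, r • x ∈ P) :
    Submodule (positiveOperators σ) M where
  __ := P
  smul_mem' := by
    rintro ⟨f, hf⟩ x hx
    change f x ∈ P
    replace hx : x ∈ P := hx
    induction hf using Subsemiring.closure_induction generalizing x with
    | mem f hf =>
      rcases hf with rfl | rfl | ⟨r, hr, rfl⟩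
      exacts [h₁ x hx, h₂ x hx, h₃ r hr x hx]
    | zero => exact P.zero_mem
    | one => exact hx
    | add f g _ _ hf hg => exact P.add_mem (hf hx) (hg hx)
    | mul f g _ _ hf hg => exact hf (hg hx)

variable {σ : M ≃ₗ[R] M} (P : Submodule (positiveOperators σ) M)

theorem apply_mem_of_mem {x : M} (hx : x ∈ P) : σ x ∈ P :=
  P.smul_mem ⟨σ.toLinearMap, Subsemiring.subset_closure (Or.inl rfl)⟩ hx

theorem symm_apply_mem_of_mem {x : M} (hx : x ∈ P) : σ.symm x ∈ P :=
  P.smul_mem ⟨σ.symm.toLinearMap, Subsemiring.subset_closure (Or.inr (Or.inl rfl))⟩ hx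

theorem smul_mem_of_nonneg {r : R} (hr : 0 ≤ r) {x : M} (hx : x ∈ P) : r • x ∈ P :=
  P.smul_mem ⟨r • LinearMap.id, Subsemiring.subset_closure (Or.inr (Or.inr ⟨r, hr, rfl⟩))⟩ hx

variable [IsOrderedAddMonoid R]

/-- The largest subspace contained in a cone. -/
def coneLineality : Submodule R M where
  carrier := {x | x ∈ P ∧ -x ∈ P}
  zero_mem' := by simp
  add_mem' := fun {x y} hx hy => ⟨P.add_mem hx.1 hy.1, by
    rw [neg_add]; exact P.add_mem hx.2 hy.2⟩
  smul_mem' := fun r x hx => by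
    rcases le_total 0 r with hr | hr
    · exact ⟨smul_mem_of_nonneg P hr hx.1, by
        rw [← smul_neg]; exact smul_mem_of_nonneg P hr hx.2⟩
    · have hr' : 0 ≤ -r := neg_nonneg.2 hr
      exact ⟨by rw [← neg_smul_neg]; exact smul_mem_of_nonneg P hr' hx.2, by
        rw [← neg_smul]; exact smul_mem_of_nonneg P hr' hx.1⟩

theorem mem_coneLineality {x : M} : x ∈ coneLineality P ↔ x ∈ P ∧ -x ∈ P := Iff.rfl

/-- The image of a cone modulo its lineality space. -/
def quotientCone : AddGroupCone (M ⧸ coneLineality P) where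
  carrier := {q | ∃ x ∈ P, (coneLineality P).mkQ x = q}
  zero_mem' := ⟨0, P.zero_mem, map_zero _⟩
  add_mem' := by
    rintro _ _ ⟨x, hx, rfl⟩ ⟨y, hy, rfl⟩
    exact ⟨x + y, P.add_mem hx hy, map_add _ _ _⟩
  eq_zero_of_mem_of_neg_mem' := by
    rintro _ ⟨x, hx, rfl⟩ ⟨y, hy, hxy⟩
    rw [← map_neg, Submodule.mkQ_apply, Submodule.mkQ_apply, Submodule.Quotient.eq] at hxy
    rw [Submodule.mkQ_apply, Submodule.Quotient.mk_eq_zero]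
    refine ⟨hx, ?_⟩
    have := P.add_mem hxy.2 hy
    rwa [show -(y - -x) + y = -x by abel] at this

/-- The lineality space lies in `P`, so membership does not depend on the representative. -/
theorem mkQ_mem_quotientCone {x : M} : (coneLineality P).mkQ x ∈ quotientCone P ↔ x ∈ P := by
  refine ⟨?_, fun hx => ⟨x, hx, rfl⟩⟩
  rintro ⟨y, hy, hxy⟩
  rw [Submodule.mkQ_apply, Submodule.mkQ_apply, Submodule.Quotient.eq] at hxy
  have := P.add_mem hxy.2 hy
  rwa [show -(y - x) + y = x by abel] at this

/-- Equality, needed for `σ` to descend to an automorphism, uses stability under `σ⁻¹` as well. -/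
theorem map_coneLineality :
    (coneLineality P).map σ.toLinearMap = coneLineality P := by
  ext x
  constructor
  · rintro ⟨y, hy, rfl⟩
    refine ⟨apply_mem_of_mem P hy.1, ?_⟩
    have := apply_mem_of_mem P hy.2
    rwa [map_neg] at this
  · intro hx
    refine ⟨σ.symm x, ⟨symm_apply_mem_of_mem P hx.1, ?_⟩, σ.apply_symm_apply x⟩
    have := symm_apply_mem_of_mem P hx.2
    rwa [map_neg] at this

end PositiveOperators

/-- The model of `R-OVSA` given by a total cone stable under `σ`. -/
theorem exists_ovsa_of_total_cone {R : Type v} [Field R] [LinearOrder R] [IsStrictOrderedRing R]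
    {M : Type u} [AddCommGroup M] [Module R M] (σ : M ≃ₗ[R] M)
    (P : Submodule (positiveOperators σ) M) (htot : ∀ x, x ∈ P ∨ -x ∈ P) :
    ∃ (D : OVSA.{u} R) (π : M →ₗ[R] D), (∀ x, 0 ≤ π x ↔ x ∈ P) ∧ ∀ x, π (σ x) = D.σ (π x) := by
  classical
  let V := coneLineality P
  let _ : HasMemOrNegMem (quotientCone P) := ⟨fun q => by
    obtain ⟨x, rfl⟩ := V.mkQ_surjective q
    rw [← map_neg, mkQ_mem_quotientCone, mkQ_mem_quotientCone]
    exact htot x⟩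
  let _ : LinearOrder (M ⧸ V) := LinearOrder.mkOfAddGroupCone (quotientCone P)
  have : IsOrderedAddMonoid (M ⧸ V) := IsOrderedAddMonoid.mkOfCone (quotientCone P)
  have nonneg_iff : ∀ x : M, 0 ≤ V.mkQ x ↔ x ∈ P := fun x => by
    rw [← mkQ_mem_quotientCone P]
    change V.mkQ x - 0 ∈ quotientCone P ↔ _
    rw [sub_zero]
  have : PosSMulMono R (M ⧸ V) := ⟨fun r hr q q' h => by
    obtain ⟨x, hx⟩ := V.mkQ_surjective (q' - q)
    rw [← sub_nonneg, ← hx, nonneg_iff] at h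
    rw [← sub_nonneg, ← smul_sub, ← hx, ← map_smul, nonneg_iff]
    exact smul_mem_of_nonneg P hr h⟩
  have : PosSMulStrictMono R (M ⧸ V) := PosSMulMono.toPosSMulStrictMono
  have : SMulPosStrictMono R (M ⧸ V) := ⟨fun q hq r s hrs => by
    rw [← sub_pos, ← sub_smul]
    exact smul_pos (sub_pos.2 hrs) hq⟩
  have : IsStrictOrderedModule R (M ⧸ V) := {}
  let τ : (M ⧸ V) ≃ₗ[R] (M ⧸ V) := Submodule.Quotient.equiv V V σ (map_coneLineality P)
  have hτ : StrictMono τ := by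
    refine Monotone.strictMono_of_injective (fun q q' h => ?_) τ.injective
    obtain ⟨x, hx⟩ := V.mkQ_surjective (q' - q)
    rw [← sub_nonneg, ← hx, nonneg_iff] at h
    rw [← sub_nonneg, ← map_sub, ← hx]
    exact (nonneg_iff (σ x)).2 (apply_mem_of_mem P h)
  exact ⟨⟨M ⧸ V, τ, hτ⟩, V.mkQ, nonneg_iff, fun x => rfl⟩

namespace OVSA

variable {R : Type v} [Field R] [LinearOrder R] [IsStrictOrderedRing R]

theorem symm_strictMono (A : OVSA.{u} R) : StrictMono A.σ.symm := fun x y h => by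
  rw [← A.σ_strictMono.lt_iff_lt]
  simpa using h

theorem Embedding.map_σ_symm {A B : OVSA.{u} R} (i : Embedding A B) (a : A) :
    i (A.σ.symm a) = B.σ.symm (i a) := by
  rw [LinearEquiv.eq_symm_apply]
  exact (i.map_σ' _).symm.trans (congrArg i (A.σ.apply_symm_apply a))

/-- The class of models of `R-OVSA` has the amalgamation property. -/
theorem amalgamateOver {A B C : OVSA.{u} R} (i : Embedding A B) (j : Embedding A C) :
    AmalgamateOver i j := by
  let σ : (B × C) ≃ₗ[R] (B × C) := B.σ.prodCongr C.σ
  have hi : StrictMono i := i.strictMono'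
  have hj : StrictMono j := j.strictMono'
  let P₀ : AddSubmonoid (B × C) :=
    { carrier := {x | ∃ a : A, i a ≤ x.1 ∧ -j a ≤ x.2}
      zero_mem' := ⟨0, by simp⟩
      add_mem' := by
        rintro x y ⟨a, ha, ha'⟩ ⟨b, hb, hb'⟩
        refine ⟨a + b, ?_, ?_⟩
        · rw [map_add]; exact add_le_add ha hb
        · rw [map_add, neg_add]; exact add_le_add ha' hb' }
  let P₁ : Submodule (positiveOperators σ) (B × C) := submoduleOfStable σ P₀
    (by
      rintro x ⟨a, ha, ha'⟩
      refine ⟨A.σ a, ?_, ?_⟩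
      · exact (i.map_σ' a).trans_le (B.σ_strictMono.monotone ha)
      · have := C.σ_strictMono.monotone ha'
        rw [map_neg] at this
        exact (congrArg Neg.neg (j.map_σ' a)).trans_le this)
    (by
      rintro x ⟨a, ha, ha'⟩
      refine ⟨A.σ.symm a, ?_, ?_⟩
      · exact (i.map_σ_symm a).trans_le (B.symm_strictMono.monotone ha)
      · have := C.symm_strictMono.monotone ha'
        rw [map_neg] at this
        exact (congrArg Neg.neg (j.map_σ_symm a)).trans_le this)
    (by
      rintro r hr x ⟨a, ha, ha'⟩
      refine ⟨r • a, ?_, ?_⟩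
      · rw [map_smul]; exact smul_le_smul_of_nonneg_left ha hr
      · rw [map_smul, ← smul_neg]; exact smul_le_smul_of_nonneg_left ha' hr)
  -- The product order is only partial, so strictness comes from monotonicity and injectivity.
  have pos_of_strictMono : ∀ {f : (B × C) ≃ₗ[R] (B × C)}, Monotone f → ∀ x, 0 < x → 0 < f x :=
    fun {f} hf x hx => by
      simpa using hf.strictMono_of_injective f.injective hx
  obtain ⟨P, hP₁, hP, htot⟩ := exists_total_submodule
    (fun t ht x hx => ((eq_zero_or_pos_of_mem_positiveOperators (σ := σ)
      (fun r hr => pos_of_strictMono (f := LinearEquiv.smulOfNeZero R _ r hr.ne') fun x y h =>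
        ⟨smul_le_smul_of_nonneg_left h.1 hr.le, smul_le_smul_of_nonneg_left h.2 hr.le⟩)
      (pos_of_strictMono fun x y h => ⟨B.σ_strictMono.monotone h.1, C.σ_strictMono.monotone h.2⟩)
      (pos_of_strictMono fun x y h =>
        ⟨B.symm_strictMono.monotone h.1, C.symm_strictMono.monotone h.2⟩) t.2).resolve_left
        fun h => ht (Subtype.ext h)) x hx) P₁ (by
      rintro x hx ⟨a, ha, ha'⟩
      -- A negative element of the cone squeezes its witness: `a ≤ 0` in `B` and `0 ≤ a` in `C`.
      have h1 : i a ≤ i 0 := by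
        rw [map_zero]; exact ha.trans (neg_nonpos.2 hx.le.1)
      have h2 : j 0 ≤ j a := by
        rw [map_zero]; exact neg_nonpos.1 (ha'.trans (neg_nonpos.2 hx.le.2))
      obtain rfl : a = 0 := le_antisymm (hi.le_iff_le.1 h1) (hj.le_iff_le.1 h2)
      rw [map_zero] at ha ha'
      rw [neg_zero] at ha'
      exact hx.not_ge ⟨neg_nonneg.1 ha, neg_nonneg.1 ha'⟩)
  obtain ⟨D, π, hπ, hπσ⟩ := exists_ovsa_of_total_cone σ P htot
  have π_pos : ∀ x, 0 < x → 0 < π x := fun x hx => by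
    rw [← not_le, ← neg_nonneg, ← map_neg, hπ]
    exact hP x hx
  refine ⟨D, ⟨π ∘ₗ LinearMap.inl R B C, fun x y h => ?_, fun b => ?_⟩,
    ⟨π ∘ₗ LinearMap.inr R B C, fun x y h => ?_, fun c => ?_⟩, fun a => ?_⟩
  · have := π_pos (y - x, 0) (Prod.mk_lt_mk_iff_left.2 (sub_pos.2 h))
    change π (x, 0) < π (y, 0)
    rw [← sub_pos, ← map_sub]
    simpa using this
  · change π (B.σ b, 0) = D.σ (π (b, 0))
    rw [← hπσ]
    exact congrArg π (Prod.ext rfl (map_zero C.σ).symm)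
  · have := π_pos (0, y - x) (Prod.mk_lt_mk_iff_right.2 (sub_pos.2 h))
    change π (0, x) < π (0, y)
    rw [← sub_pos, ← map_sub]
    simpa using this
  · change π (0, C.σ c) = D.σ (π (0, c))
    rw [← hπσ]
    exact congrArg π (Prod.ext (map_zero B.σ).symm rfl)
  · change π (i a, 0) = π (0, j a)
    -- The witnesses `a` and `-a` put this element and its negative in the cone, so `π` kills it.
    have h1 : 0 ≤ π (i a, -j a) := (hπ _).2 (hP₁ ⟨a, le_rfl, le_rfl⟩)
    have h2 : 0 ≤ π (-i a, j a) :=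
      (hπ _).2 (hP₁ ⟨-a, (map_neg i.toLinearMap a).le, by simp⟩)
    apply le_antisymm
    · rw [← sub_nonneg, ← map_sub]; simpa using h2
    · rw [← sub_nonneg, ← map_sub]; simpa using h1

end OVSA

theorem mainTheorem2 (A B C : OVSA.{u} ℝ) (i : OVSA.Embedding A B) (j : OVSA.Embedding A C)
    (hB : ∀ b : B, ∃ p : OVSA.SigmaPolynomial A, p ≠ 0 ∧ p.eval i b = 0) :
    OVSA.AmalgamateOver i j :=
  OVSA.amalgamateOver i j
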